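/- Let $R$ be a commutative unital ring, let $A$ and $B$ be unital $R$-algebras, and let $M$ be an $(A,B)$-bimodule over $R$ that is faithful, i.e. for $a\in A$, $aM=\{0\}$ implies $a=0$, and for $b\in B$, $Mb=\{0\}$ implies $b=0$. Let $$\mathcal T=\mathcal T(A,M,B)=\left\{\begin{pmatrix}a&m\\0&b\end{pmatrix}: a\in A,\ m\in M,\ b\in B\right\}$$ be the associated triangular algebra, with the usual matrix operations. Put $e=\begin{pmatrix}1&0\\0&0\end{pmatrix}$ and $f=1-e$, and identify $A$ with $e\mathcal Te$ and $B$ with $f\mathcal Tf$. For a unital $R$-algebra $\mathcal C$ write $\mathcal Z(\mathcal C)$ for its centre, $[x,y]=xy-yx$, and $\mathcal S(\mathcal C)$ for the subalgebra generated by all idempotents and all commutators $[x,y]$ of $\mathcal C$. Let $p_1(x_1)=x_1$ and $p_k(x_1,\dots,x_k)=[p_{k-1}(x_1,\dots,x_{k-1}),x_k]$ for $k\ge 2$; the element $p_k(x_1,\dots,x_k)$ is called a $(k-1)$-th commutator. Let $n\ge 2$, and suppose that $\mathcal T$ is $2$- and $(n-1)$-torsion free: for $x\in\mathcal T$, each of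 $2x=0$ and $(n-1)x=0$ implies $x=0$. Suppose that at least one of the following holds: (i) $A=\mathcal S(A)$ and $B=\mathcal S(B)$; (ii) $\mathcal T=\mathcal S(\mathcal T)$; (iii) $A=\mathcal S(A)$ and $\mathcal Z(A)=e\mathcal Z(\mathcal T)e$; (iv) $B=\mathcal S(B)$ and $\mathcal Z(B)=f\mathcal Z(\mathcal T)f$; (v) $\mathcal Z(A)=e\mathcal Z(\mathcal T)e$, $\mathcal Z(B)=f\mathcal Z(\mathcal T)f$, and, in case $n\ge 3$, at least one algebra $\mathcal C\in\{A,B\}$ has the property that, for $x\in\mathcal C$, $[x,\mathcal C]\subseteq\mathcal Z(\mathcal C)$ implies $x\in\mathcal Z(\mathcal C)$. Then every Lie $n$-derivation $\varphi$ on $\mathcal T$, i.e. every $R$-linear map $\varphi:\mathcal T\to\mathcal T$ with $$\varphi(p_n(x_1,\dots,x_n))=\sum_{i=1}^n p_n(x_1,\dots,x_{i-1},\varphi(x_i),x_{i+1},\dots,x_n)\qquad(x_1,\dots,x_n\in\mathcal T),$$ is standard: $\varphi=h+\tau$, where $h$ is an $R$-linear derivation of $\mathcal T$ and $\tau:\mathcal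 T\to\mathcal Z(\mathcal T)$ is an $R$-linear map with $\tau(p_n(x_1,\dots,x_n))=0$ for all $x_1,\dots,x_n\in\mathcal T$. -/

import Mathlib

/-- The triangular algebra with diagonal corners `A`, `B` and off-diagonal corner `M`: formal
upper triangular `2 × 2` matrices with rows `(a, m)` and `(0, b)`. -/
@[ext]
structure TriangularAlgebra (A M B : Type*) where
  a : A
  m : M
  b : B

namespace TriangularAlgebra

set_option linter.unusedSectionVars false

section Additive

variable {A M B : Type*} [AddCommGroup A] [AddCommGroup M] [AddCommGroup B]

instance : Zero (TriangularAlgebra A M B) := ⟨⟨0, 0, 0⟩⟩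
instance : Add (TriangularAlgebra A M B) := ⟨fun x y => ⟨x.a + y.a, x.m + y.m, x.b + y.b⟩⟩
instance : Neg (TriangularAlgebra A M B) := ⟨fun x => ⟨-x.a, -x.m, -x.b⟩⟩
instance : Sub (TriangularAlgebra A M B) := ⟨fun x y => ⟨x.a - y.a, x.m - y.m, x.b - y.b⟩⟩

instance {S : Type*} [SMul S A] [SMul S M] [SMul S B] : SMul S (TriangularAlgebra A M B) :=
  ⟨fun s x => ⟨s • x.a, s • x.m, s • x.b⟩⟩

@[simp] theorem zero_a : (0 : TriangularAlgebra A M B).a = 0 := rfl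
@[simp] theorem zero_m : (0 : TriangularAlgebra A M B).m = 0 := rfl
@[simp] theorem zero_b : (0 : TriangularAlgebra A M B).b = 0 := rfl
@[simp] theorem add_a (x y : TriangularAlgebra A M B) : (x + y).a = x.a + y.a := rfl
@[simp] theorem add_m (x y : TriangularAlgebra A M B) : (x + y).m = x.m + y.m := rfl
@[simp] theorem add_b (x y : TriangularAlgebra A M B) : (x + y).b = x.b + y.b := rfl
@[simp] theorem neg_a (x : TriangularAlgebra A M B) : (-x).a = -x.a := rfl
@[simp] theorem neg_m (x : TriangularAlgebra A M B) : (-x).m = -x.m := rfl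
@[simp] theorem neg_b (x : TriangularAlgebra A M B) : (-x).b = -x.b := rfl
@[simp] theorem sub_a (x y : TriangularAlgebra A M B) : (x - y).a = x.a - y.a := rfl
@[simp] theorem sub_m (x y : TriangularAlgebra A M B) : (x - y).m = x.m - y.m := rfl
@[simp] theorem sub_b (x y : TriangularAlgebra A M B) : (x - y).b = x.b - y.b := rfl

section SMul

variable {S : Type*} [SMul S A] [SMul S M] [SMul S B]

@[simp] theorem smul_a (s : S) (x : TriangularAlgebra A M B) : (s • x).a = s • x.a := rfl
@[simp] theorem smul_m (s : S) (x : TriangularAlgebra A M B) : (s • x).m = s • x.m := rfl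
@[simp] theorem smul_b (s : S) (x : TriangularAlgebra A M B) : (s • x).b = s • x.b := rfl

end SMul

instance : AddCommGroup (TriangularAlgebra A M B) :=
  Function.Injective.addCommGroup
    (fun x : TriangularAlgebra A M B => (x.a, x.m, x.b))
    (fun x y h => by
      simp only [Prod.mk.injEq] at h
      exact TriangularAlgebra.ext h.1 h.2.1 h.2.2)
    rfl (fun _ _ => rfl) (fun _ => rfl) (fun _ _ => rfl) (fun _ _ => rfl) (fun _ _ => rfl)

end Additive

section Algebra

variable {R A M B : Type*} [CommRing R] [Ring A] [Ring B] [Algebra R A] [Algebra R B]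
  [AddCommGroup M] [Module R M] [Module A M] [Module Bᵐᵒᵖ M] [SMulCommClass A Bᵐᵒᵖ M]

instance : One (TriangularAlgebra A M B) := ⟨⟨1, 0, 1⟩⟩

/-- Matrix multiplication; the right action of `y.b` on `x.m` is written `MulOpposite.op y.b • x.m`. -/
instance : Mul (TriangularAlgebra A M B) :=
  ⟨fun x y => ⟨x.a * y.a, x.a • y.m + MulOpposite.op y.b • x.m, x.b * y.b⟩⟩

@[simp] theorem one_a : (1 : TriangularAlgebra A M B).a = 1 := rfl
@[simp] theorem one_m : (1 : TriangularAlgebra A M B).m = 0 := rfl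
@[simp] theorem one_b : (1 : TriangularAlgebra A M B).b = 1 := rfl
@[simp] theorem mul_a (x y : TriangularAlgebra A M B) : (x * y).a = x.a * y.a := rfl
@[simp] theorem mul_m (x y : TriangularAlgebra A M B) :
    (x * y).m = x.a • y.m + MulOpposite.op y.b • x.m := rfl
@[simp] theorem mul_b (x y : TriangularAlgebra A M B) : (x * y).b = x.b * y.b := rfl

instance : Ring (TriangularAlgebra A M B) :=
  { (inferInstance : AddCommGroup (TriangularAlgebra A M B)) with
    mul_assoc := fun x y z => by
      ext
      · simp [mul_assoc]
      · simp [mul_smul, smul_comm, add_assoc]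
      · simp [mul_assoc]
    one_mul := fun x => by ext <;> simp
    mul_one := fun x => by ext <;> simp
    zero_mul := fun x => by ext <;> simp
    mul_zero := fun x => by ext <;> simp
    left_distrib := fun x y z => by
      ext
      · simp [mul_add]
      · simp only [mul_m, add_m, add_b, MulOpposite.op_add, smul_add, add_smul]
        abel
      · simp [mul_add]
    right_distrib := fun x y z => by
      ext
      · simp [add_mul]
      · simp only [mul_m, add_m, add_a, smul_add, add_smul]
        abel
      · simp [add_mul] }

instance : Module R (TriangularAlgebra A M B) where
  one_smul x := by ext <;> simp
  mul_smul r s x := by ext <;> simp [mul_smul]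
  smul_zero r := by ext <;> simp
  smul_add r x y := by ext <;> simp
  add_smul r s x := by ext <;> simp [add_smul]
  zero_smul x := by ext <;> simp

instance [IsScalarTower R A M] [IsScalarTower R Bᵐᵒᵖ M] : Algebra R (TriangularAlgebra A M B) :=
  Algebra.ofModule
    (fun r x y => by
      ext
      · simp
      · simp only [mul_m, smul_a, smul_m, smul_add, smul_assoc]
        rw [← algebraMap_smul Bᵐᵒᵖ r x.m, ← algebraMap_smul Bᵐᵒᵖ r (MulOpposite.op y.b • x.m),
          smul_smul, smul_smul, Algebra.commutes]
      · simp)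
    (fun r x y => by
      ext
      · simp
      · simp only [mul_m, smul_b, smul_m, smul_add, MulOpposite.op_smul, smul_assoc]
        rw [← algebraMap_smul A r y.m, ← algebraMap_smul A r (x.a • y.m),
          smul_smul, smul_smul, Algebra.commutes]
      · simp)

variable (A M B) in
/-- The idempotent `e`, with rows `(1, 0)` and `(0, 0)`. -/
def e : TriangularAlgebra A M B := ⟨1, 0, 0⟩

variable (A M B) in
/-- The idempotent `f = 1 - e`. -/
def f : TriangularAlgebra A M B := 1 - e A M B

variable (M B) in
/-- The identification of `a : A` with the matrix having rows `(a, 0)` and `(0, 0)`. -/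
def ofA (a : A) : TriangularAlgebra A M B := ⟨a, 0, 0⟩

variable (A M) in
/-- The identification of `b : B` with the matrix having rows `(0, 0)` and `(0, b)`. -/
def ofB (b : B) : TriangularAlgebra A M B := ⟨0, 0, b⟩

end Algebra

end TriangularAlgebra

/-- `T` is `k`-torsion free. -/
def IsTorsionFreeBy (k : ℕ) (T : Type*) [AddCommGroup T] : Prop :=
  ∀ x : T, k • x = 0 → x = 0

/-- The iterated commutator `p_n(x₁, …, x_n) = [… [[x₁, x₂], x₃], …, x_n]`, an `(n-1)`-th
commutator (with the irrelevant convention `p_0 = 0`). Here `⁅x, y⁆ = x * y - y * x`. -/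
def iterComm {T : Type*} [Ring T] : (n : ℕ) → (Fin n → T) → T
  | 0, _ => 0
  | 1, x => x 0
  | n + 2, x => ⁅iterComm (n + 1) (fun i => x i.castSucc), x (Fin.last (n + 1))⁆

/-- Lie `n`-derivations. -/
def IsLieNDerivation {R T : Type*} [CommRing R] [Ring T] [Algebra R T] (n : ℕ)
    (φ : T →ₗ[R] T) : Prop :=
  ∀ x : Fin n → T,
    φ (iterComm n x) = ∑ i : Fin n, iterComm n (Function.update x i (φ (x i)))

/-- The map `φ` is the sum of a derivation and a linear map into the centre that vanishes on all
`(n-1)`-th commutators. -/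
def IsStandardLieN {R T : Type*} [CommRing R] [Ring T] [Algebra R T] (n : ℕ)
    (φ : T →ₗ[R] T) : Prop :=
  ∃ h τ : T →ₗ[R] T,
    (∀ x y : T, h (x * y) = h x * y + x * h y) ∧
    (∀ x : T, τ x ∈ Subalgebra.center R T) ∧
    (∀ x : Fin n → T, τ (iterComm n x) = 0) ∧
    φ = h + τ

/-- The subalgebra generated by all idempotents and all commutators. -/
def idemCommSubalgebra (R T : Type*) [CommRing R] [Ring T] [Algebra R T] : Subalgebra R T :=
  Algebra.adjoin R ({x : T | IsIdempotentElem x} ∪ {x : T | ∃ y z : T, x = ⁅y, z⁆})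

/-- If `[x, T]` is contained in the centre, then so is `x`. -/
def CentralCommutatorCondition (R T : Type*) [CommRing R] [Ring T] [Algebra R T] : Prop :=
  ∀ x : T, (∀ y : T, ⁅x, y⁆ ∈ Subalgebra.center R T) → x ∈ Subalgebra.center R T

/-- The set `u Z(T) u`. -/
def centerCorner (R : Type*) {T : Type*} [CommRing R] [Ring T] [Algebra R T] (u : T) : Set T :=
  {x : T | ∃ z ∈ Subalgebra.center R T, x = u * z * u}

/-! Write n = k + 2. Bracketing with `f` on the right fixes every element of M and annihilates
diagonal matrices, so a tail of entries `f` reads off the M-entry of a shorter commutator.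

Subtracting an inner derivation makes the M-entry of φ(e) zero. The tuple (m, f, …, f) then shows
that (n - 1)⁅m, φ(f)⁆ = 0; hence φ(f) is central and φ maps M into M (`lie_ofM_map_f`, `map_ofM_eq`,
`map_f_mem_center`). With φ(f) central, tails of `f` turn the n-ary identity into binary ones,
collected in `cornerIdentities`: for example μ(am) = α(a)m - mα'(a) + aμ(m), where α' : A → B and β'
: B → A are the parts of φ that cross between the diagonal corners.

The map φ is standard as soon as each α'(a) acts on M like an element of A and each β'(b) like an
element of B: the crossing parts, completed by these partners, form a central map, and faithfulness
makes the rest a derivation (`isStandard_of_exists`). Partners come from two sources. Expanding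
μ(acm) in two ways shows that the elements of A whose image under α' has a partner are closed under
products and include all idempotents and commutators (`exists_left_of_idemComm`). Alternatively, the
relation ⁅a, β'(b)⁆m = m⁅α'(a), b⁆ forces centrality, and the hypothesis on the centres of the
corners supplies the partner. -/

section Bracket

variable {T : Type*} [Ring T]

theorem Ring.add_lie (x y z : T) : ⁅x + y, z⁆ = ⁅x, z⁆ + ⁅y, z⁆ := by
  simp only [Ring.lie_def, add_mul, mul_add]
  abel

theorem Ring.sub_lie (x y z : T) : ⁅x - y, z⁆ = ⁅x, z⁆ - ⁅y, z⁆ := by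
  simp only [Ring.lie_def, sub_mul, mul_sub]
  abel

theorem Ring.lie_sub (x y z : T) : ⁅x, y - z⁆ = ⁅x, y⁆ - ⁅x, z⁆ := by
  simp only [Ring.lie_def, sub_mul, mul_sub]
  abel

theorem Ring.zero_lie (x : T) : ⁅(0 : T), x⁆ = 0 := by
  simp only [Ring.lie_def, zero_mul, mul_zero, sub_zero]

theorem Ring.neg_lie_swap (x y : T) : -⁅x, y⁆ = ⁅y, x⁆ := by
  simp only [Ring.lie_def, neg_sub]

end Bracket

section UpdateComp

variable {T : Type*}

theorem update_castSucc_comp {n : ℕ} (x : Fin (n + 1) → T) (i : Fin n) (y : T) :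
    (fun j : Fin n => Function.update x i.castSucc y j.castSucc) =
      Function.update (fun j : Fin n => x j.castSucc) i y := by
  funext j
  by_cases hj : j = i
  · subst hj; simp
  · rw [Function.update_of_ne hj,
      Function.update_of_ne (fun h => hj (Fin.castSucc_injective _ h))]

theorem update_last_comp {n : ℕ} (x : Fin (n + 1) → T) (y : T) :
    (fun j : Fin n => Function.update x (Fin.last n) y j.castSucc) =
      fun j : Fin n => x j.castSucc := by
  funext j
  exact Function.update_of_ne (Fin.castSucc_lt_last j).ne _ _

/-- The tuple `(u, v, c, …, c)`. -/
def headTwo (k : ℕ) (u v c : T) : Fin (k + 2) → T := Fin.cons u (Fin.cons v fun _ => c)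

theorem headTwo_of_two_le {k : ℕ} (u v c : T) (i : Fin (k + 2)) (hi : 2 ≤ i.val) :
    headTwo k u v c i = c := by
  induction i using Fin.cases with
  | zero => simp at hi
  | succ i =>
    induction i using Fin.cases with
    | zero => simp at hi
    | succ i => simp [headTwo]

end UpdateComp

/-! ### Iterated commutators with a central entry, a commuting head or a constant tail. -/

section IterComm

variable {T : Type*} [Ring T]

theorem iterComm_add_two (n : ℕ) (x : Fin (n + 2) → T) :
    iterComm (n + 2) x =
      ⁅iterComm (n + 1) (fun i => x i.castSucc), x (Fin.last (n + 1))⁆ := rfl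

theorem iterComm_update_castSucc (n : ℕ) (x : Fin (n + 2) → T) (i : Fin (n + 1)) (y : T) :
    iterComm (n + 2) (Function.update x i.castSucc y) =
      ⁅iterComm (n + 1) (Function.update (fun j => x j.castSucc) i y), x (Fin.last (n + 1))⁆ := by
  rw [iterComm_add_two, update_castSucc_comp,
    Function.update_of_ne (Fin.castSucc_lt_last i).ne']

theorem iterComm_update_last (n : ℕ) (x : Fin (n + 2) → T) (y : T) :
    iterComm (n + 2) (Function.update x (Fin.last (n + 1)) y) =
      ⁅iterComm (n + 1) (fun j => x j.castSucc), y⁆ := by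
  rw [iterComm_add_two, update_last_comp, Function.update_self]

theorem iterComm_update_sub (n : ℕ) (x : Fin n → T) (i : Fin n) (y z : T) :
    iterComm n (Function.update x i (y - z)) =
      iterComm n (Function.update x i y) - iterComm n (Function.update x i z) := by
  match n with
  | 0 => exact i.elim0
  | 1 =>
    obtain rfl := Subsingleton.elim i 0
    simp [iterComm]
  | n + 2 =>
    induction i using Fin.lastCases with
    | last => simp only [iterComm_update_last, Ring.lie_sub]
    | cast i =>
      simp only [iterComm_update_castSucc]
      rw [iterComm_update_sub (n + 1), Ring.sub_lie]

/-- Iterated commutators of length at least two vanish if one of the entries commutes with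
everything. -/
theorem iterComm_eq_zero_of_central (n : ℕ) (x : Fin (n + 2) → T) (i : Fin (n + 2))
    (hi : ∀ y : T, ⁅x i, y⁆ = 0) : iterComm (n + 2) x = 0 := by
  have hi' : ∀ y : T, ⁅y, x i⁆ = 0 := fun y => by rw [← Ring.neg_lie_swap, hi, neg_zero]
  induction n with
  | zero =>
    fin_cases i
    · exact hi _
    · exact hi' _
  | succ n ih =>
    rw [iterComm_add_two]
    induction i using Fin.lastCases with
    | last => exact hi' _
    | cast i =>
      rw [ih (fun j => x j.castSucc) i hi hi', Ring.zero_lie]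

theorem iterComm_eq_zero_of_commute (n : ℕ) (x : Fin (n + 2) → T) (h : ⁅x 0, x 1⁆ = 0) :
    iterComm (n + 2) x = 0 := by
  induction n with
  | zero => exact h
  | succ n ih =>
    rw [iterComm_add_two, ih (fun j => x j.castSucc) h, Ring.zero_lie]

/-- The map `y ↦ ⁅y, f⁆`. -/
def rightAd (u : T) (y : T) : T := ⁅y, u⁆

/-- A constant tail turns the iterated commutator into a power of one operator, which is easy to
evaluate when `u` is `f`. -/
theorem iterComm_eq_iterate_two (u : T) (k : ℕ) (x : Fin (k + 2) → T)
    (hx : ∀ i : Fin (k + 2), 2 ≤ i.val → x i = u) :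
    iterComm (k + 2) x = (rightAd u)^[k] ⁅x 0, x 1⁆ := by
  induction k with
  | zero => rfl
  | succ k ih =>
    rw [iterComm_add_two, ih (fun j => x j.castSucc) (fun i hi => hx _ hi),
      hx (Fin.last _) (by simp), Function.iterate_succ_apply']
    rfl

theorem iterComm_eq_iterate_three (u : T) (k : ℕ) (x : Fin (k + 3) → T)
    (hx : ∀ i : Fin (k + 3), 3 ≤ i.val → x i = u) :
    iterComm (k + 3) x = (rightAd u)^[k] ⁅⁅x 0, x 1⁆, x 2⁆ := by
  induction k with
  | zero => rfl
  | succ k ih =>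
    rw [iterComm_add_two, ih (fun j => x j.castSucc) (fun i hi => hx _ hi),
      hx (Fin.last _) (by simp), Function.iterate_succ_apply']
    rfl

theorem rightAd_iterate_add (u : T) (k : ℕ) (y z : T) :
    (rightAd u)^[k] (y + z) = (rightAd u)^[k] y + (rightAd u)^[k] z := by
  induction k with
  | zero => rfl
  | succ k ih =>
    simp only [Function.iterate_succ_apply', ih]
    exact Ring.add_lie _ _ _

theorem rightAd_iterate_zero (u : T) (k : ℕ) : (rightAd u)^[k] 0 = 0 :=
  Function.iterate_fixed (Ring.zero_lie u) k

end IterComm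

/-! ### Lie n-derivations of a general algebra and their values on special tuples. -/

section Derivations

variable {R T : Type*} [CommRing R] [Ring T] [Algebra R T]

theorem lie_leibniz_of_leibniz {h : T →ₗ[R] T} (hh : ∀ x y, h (x * y) = h x * y + x * h y)
    (x y : T) : h ⁅x, y⁆ = ⁅h x, y⁆ + ⁅x, h y⁆ := by
  simp only [Ring.lie_def, map_sub, hh]
  abel

theorem isLieNDerivation_of_leibniz {h : T →ₗ[R] T}
    (hh : ∀ x y, h (x * y) = h x * y + x * h y) (n : ℕ) : IsLieNDerivation n h := by
  match n with
  | 0 => intro x; simp [iterComm]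
  | 1 => intro x; simp [iterComm]
  | n + 2 =>
    intro x
    rw [Fin.sum_univ_castSucc, iterComm_add_two, lie_leibniz_of_leibniz hh,
      isLieNDerivation_of_leibniz hh (n + 1), iterComm_update_last]
    simp only [iterComm_update_castSucc]
    congr 1
    simp only [Ring.lie_def, Finset.sum_mul, Finset.mul_sum, Finset.sum_sub_distrib]

theorem IsLieNDerivation.sub {n : ℕ} {φ ψ : T →ₗ[R] T} (hφ : IsLieNDerivation n φ)
    (hψ : IsLieNDerivation n ψ) : IsLieNDerivation n (φ - ψ) := by
  intro x
  simp only [LinearMap.sub_apply, hφ x, hψ x, iterComm_update_sub, Finset.sum_sub_distrib]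

theorem lie_eq_zero_of_mem_center {z : T} (hz : z ∈ Subalgebra.center R T) (y : T) :
    ⁅z, y⁆ = 0 := by
  rw [Ring.lie_def, Subalgebra.mem_center_iff.1 hz y, sub_self]

theorem lie_eq_zero_of_mem_center' {z : T} (hz : z ∈ Subalgebra.center R T) (y : T) :
    ⁅y, z⁆ = 0 := by
  rw [Ring.lie_def, Subalgebra.mem_center_iff.1 hz y, sub_self]

/-- Each summand of the defining identity has a central entry. Hence only centrality of τ needs
checking later, never its vanishing on commutators. -/
theorem IsLieNDerivation.eq_zero_of_central {n : ℕ} (hn : 2 ≤ n) {τ : T →ₗ[R] T}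
    (hτ : IsLieNDerivation n τ) (hc : ∀ x, τ x ∈ Subalgebra.center R T) (x : Fin n → T) :
    τ (iterComm n x) = 0 := by
  obtain ⟨n, rfl⟩ := Nat.exists_eq_add_of_le' hn
  rw [hτ x]
  refine Finset.sum_eq_zero fun i _ => iterComm_eq_zero_of_central n _ i ?_
  rw [Function.update_self]
  exact lie_eq_zero_of_mem_center (hc _)

/-- A Lie `n`-derivation that differs from a derivation by a central map is standard. -/
theorem IsLieNDerivation.isStandard {n : ℕ} (hn : 2 ≤ n) {φ h τ : T →ₗ[R] T}
    (hφ : IsLieNDerivation n φ) (hh : ∀ x y, h (x * y) = h x * y + x * h y)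
    (hc : ∀ x, τ x ∈ Subalgebra.center R T) (heq : φ = h + τ) : IsStandardLieN n φ := by
  refine ⟨h, τ, hh, hc, ?_, heq⟩
  have : τ = φ - h := by rw [heq, add_sub_cancel_left]
  exact IsLieNDerivation.eq_zero_of_central hn
    (this ▸ hφ.sub (isLieNDerivation_of_leibniz hh n)) hc

/-- The inner derivation `x ↦ ⁅x, u⁆`. -/
def innerDer (R : Type*) {T : Type*} [CommRing R] [Ring T] [Algebra R T] (u : T) : T →ₗ[R] T :=
  LinearMap.mulRight R u - LinearMap.mulLeft R u

theorem innerDer_apply (u x : T) : innerDer R u x = ⁅x, u⁆ := rfl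

theorem innerDer_leibniz (u x y : T) :
    innerDer R u (x * y) = innerDer R u x * y + x * innerDer R u y := by
  simp only [innerDer_apply, Ring.lie_def]
  noncomm_ring

theorem IsStandardLieN.of_sub_innerDer {n : ℕ} {φ : T →ₗ[R] T} (u : T)
    (h : IsStandardLieN n (φ - innerDer R u)) : IsStandardLieN n φ := by
  obtain ⟨h, τ, hh, hc, h0, heq⟩ := h
  refine ⟨h + innerDer R u, τ, fun x y => ?_, hc, h0, ?_⟩
  · simp only [LinearMap.add_apply, hh, innerDer_leibniz, add_mul, mul_add]
    abel
  · rw [add_right_comm, ← heq, sub_add_cancel]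

theorem iterComm_update_one_eq_zero_of_commute {n : ℕ} (x : Fin (n + 2) → T) (i : Fin (n + 2))
    (hi : 2 ≤ i.val) (y : T) (h : ⁅x 0, x 1⁆ = 0) :
    iterComm (n + 2) (Function.update x i y) = 0 := by
  refine iterComm_eq_zero_of_commute n _ ?_
  rw [Function.update_of_ne, Function.update_of_ne, h]
  · rintro rfl; simp at hi
  · rintro rfl; simp at hi

/-- The defining identity evaluated at `(u, v, c, …, c)` with the later terms collected. -/
theorem IsLieNDerivation.apply_headTwo {k : ℕ} {φ : T →ₗ[R] T} (hφ : IsLieNDerivation (k + 2) φ)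
    (u v c : T) :
    φ ((rightAd c)^[k] ⁅u, v⁆) = (rightAd c)^[k] (⁅φ u, v⁆ + ⁅u, φ v⁆) +
      ∑ i : Fin k, iterComm (k + 2) (Function.update (headTwo k u v c) i.succ.succ (φ c)) := by
  have h := hφ (headTwo k u v c)
  have hc := headTwo_of_two_le (k := k) u v c
  rw [iterComm_eq_iterate_two c k _ hc, Fin.sum_univ_succ, Fin.sum_univ_succ,
    iterComm_eq_iterate_two c k, iterComm_eq_iterate_two c k] at h
  · simp only [hc _ (show 2 ≤ (Fin.succ (Fin.succ _) : Fin (k + 2)).val by simp)] at h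
    rw [rightAd_iterate_add, add_assoc]
    exact h
  · intro i hi
    rw [Function.update_of_ne, hc i hi]
    rintro rfl; simp at hi
  · intro i hi
    rw [Function.update_of_ne, hc i hi]
    rintro rfl; simp at hi

theorem IsLieNDerivation.apply_headTwo_of_central {k : ℕ} {φ : T →ₗ[R] T}
    (hφ : IsLieNDerivation (k + 2) φ) (u v c : T) (hc : φ c ∈ Subalgebra.center R T) :
    φ ((rightAd c)^[k] ⁅u, v⁆) = (rightAd c)^[k] (⁅φ u, v⁆ + ⁅u, φ v⁆) := by
  rw [hφ.apply_headTwo, add_eq_left]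
  refine Finset.sum_eq_zero fun i _ => iterComm_eq_zero_of_central k _ i.succ.succ ?_
  rw [Function.update_self]
  exact lie_eq_zero_of_mem_center hc

/-- Commuting arguments give a relation free of terms involving `φ` at the later entries. -/
theorem IsLieNDerivation.apply_headTwo_of_commute {k : ℕ} {φ : T →ₗ[R] T}
    (hφ : IsLieNDerivation (k + 2) φ) (u v c : T) (huv : ⁅u, v⁆ = 0) :
    (rightAd c)^[k] (⁅φ u, v⁆ + ⁅u, φ v⁆) = 0 := by
  have h := hφ.apply_headTwo u v c
  rw [huv, rightAd_iterate_zero, map_zero, Finset.sum_eq_zero, add_zero] at h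
  · exact h.symm
  · exact fun i _ => iterComm_update_one_eq_zero_of_commute _ _ (by simp) _ huv

theorem IsLieNDerivation.apply_headThree_of_commute {k : ℕ} {φ : T →ₗ[R] T}
    (hφ : IsLieNDerivation (k + 3) φ) (u v w c : T) (huv : ⁅u, v⁆ = 0) :
    (rightAd c)^[k] ⁅⁅φ u, v⁆ + ⁅u, φ v⁆, w⁆ = 0 := by
  let x : Fin (k + 3) → T := Fin.cons u (headTwo k v w c)
  have hx : ∀ i : Fin (k + 3), 3 ≤ i.val → x i = c := by
    intro i hi
    induction i using Fin.cases with
    | zero => simp at hi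
    | succ i => exact headTwo_of_two_le v w c i (by simpa using hi)
  have h := hφ x
  rw [iterComm_eq_zero_of_commute (k + 1) x huv, map_zero, Fin.sum_univ_succ, Fin.sum_univ_succ,
    iterComm_eq_iterate_three c k, iterComm_eq_iterate_three c k, Finset.sum_eq_zero, add_zero,
    ← rightAd_iterate_add] at h
  · rw [Ring.add_lie]
    exact h.symm
  · exact fun i _ => iterComm_update_one_eq_zero_of_commute (n := k + 1) _ _ (by simp) _ huv
  · intro i hi
    rw [Function.update_of_ne, hx i hi]
    rintro rfl; simp at hi
  · intro i hi
    rw [Function.update_of_ne, hx i hi]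
    rintro rfl; simp at hi

end Derivations

/-! ### Corners of the triangular algebra and elements acting alike on M. -/

namespace TriangularAlgebra

set_option linter.unusedSectionVars false

open MulOpposite

variable {R A M B : Type*} [CommRing R] [Ring A] [Ring B] [Algebra R A] [Algebra R B]
  [AddCommGroup M] [Module R M] [Module A M] [Module Bᵐᵒᵖ M] [SMulCommClass A Bᵐᵒᵖ M]

variable (A B) in
/-- The matrix with rows `(0, m)` and `(0, 0)`. -/
def ofM (m : M) : TriangularAlgebra A M B := ⟨0, m, 0⟩

@[simp] theorem ofA_a (a : A) : (ofA M B a).a = a := rfl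
@[simp] theorem ofA_m (a : A) : (ofA M B a).m = 0 := rfl
@[simp] theorem ofA_b (a : A) : (ofA M B a).b = 0 := rfl
@[simp] theorem ofB_a (b : B) : (ofB A M b).a = 0 := rfl
@[simp] theorem ofB_m (b : B) : (ofB A M b).m = 0 := rfl
@[simp] theorem ofB_b (b : B) : (ofB A M b).b = b := rfl
@[simp] theorem ofM_a (m : M) : (ofM A B m).a = 0 := rfl
@[simp] theorem ofM_m (m : M) : (ofM A B m).m = m := rfl
@[simp] theorem ofM_b (m : M) : (ofM A B m).b = 0 := rfl
@[simp] theorem e_a : (e A M B).a = 1 := rfl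
@[simp] theorem e_m : (e A M B).m = 0 := rfl
@[simp] theorem e_b : (e A M B).b = 0 := rfl
@[simp] theorem f_a : (f A M B).a = 0 := sub_self 1
@[simp] theorem f_m : (f A M B).m = 0 := sub_self 0
@[simp] theorem f_b : (f A M B).b = 1 := sub_zero 1

@[simp] theorem lie_a (x y : TriangularAlgebra A M B) : (⁅x, y⁆).a = ⁅x.a, y.a⁆ := rfl
@[simp] theorem lie_b (x y : TriangularAlgebra A M B) : (⁅x, y⁆).b = ⁅x.b, y.b⁆ := rfl
@[simp] theorem lie_m (x y : TriangularAlgebra A M B) :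
    (⁅x, y⁆).m = (x.a • y.m + op y.b • x.m) - (y.a • x.m + op x.b • y.m) := rfl

theorem eq_sum (x : TriangularAlgebra A M B) : x = ofA M B x.a + ofM A B x.m + ofB A M x.b := by
  ext <;> simp

variable (R M B) in
/-- `ofA` as a linear map. -/
def ofALin : A →ₗ[R] TriangularAlgebra A M B where
  toFun := ofA M B
  map_add' x y := by ext <;> simp
  map_smul' r x := by ext <;> simp

variable (R A M) in
/-- `ofB` as a linear map. -/
def ofBLin : B →ₗ[R] TriangularAlgebra A M B where
  toFun := ofB A M
  map_add' x y := by ext <;> simp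
  map_smul' r x := by ext <;> simp

variable (R A B) in
/-- `ofM` as a linear map. -/
def ofMLin : M →ₗ[R] TriangularAlgebra A M B where
  toFun := ofM A B
  map_add' x y := by ext <;> simp
  map_smul' r x := by ext <;> simp

variable (R A M B) in
/-- The projection onto the corner `A`. -/
def projA : TriangularAlgebra A M B →ₗ[R] A where
  toFun := TriangularAlgebra.a
  map_add' _ _ := rfl
  map_smul' _ _ := rfl

variable (R A M B) in
/-- The projection onto the corner `B`. -/
def projB : TriangularAlgebra A M B →ₗ[R] B where
  toFun := TriangularAlgebra.b
  map_add' _ _ := rfl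
  map_smul' _ _ := rfl

variable (R A M B) in
/-- The projection onto the corner `M`. -/
def projM : TriangularAlgebra A M B →ₗ[R] M where
  toFun := TriangularAlgebra.m
  map_add' _ _ := rfl
  map_smul' _ _ := rfl

variable (M) in
/-- `a` and `b` act in the same way on `M`. -/
def ActsSame (a : A) (b : B) : Prop := ∀ m : M, a • m = op b • m

namespace ActsSame

theorem add {a a' : A} {b b' : B} (h : ActsSame M a b) (h' : ActsSame M a' b') :
    ActsSame M (a + a') (b + b') := fun m => by
  rw [add_smul, op_add, add_smul, h m, h' m]

theorem smul [IsScalarTower R A M] [IsScalarTower R Bᵐᵒᵖ M] (r : R) {a : A} {b : B}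
    (h : ActsSame M a b) : ActsSame M (r • a) (r • b) := fun m => by
  rw [smul_assoc, op_smul, smul_assoc, h m]

/-- On M, `a` is a right multiplication, so it commutes with all left multiplications; faithfulness
carries this back to A. -/
theorem left_comm (faithful_left : ∀ a : A, (∀ m : M, a • m = 0) → a = 0) {a : A} {b : B}
    (h : ActsSame M a b) (c : A) : c * a = a * c :=
  sub_eq_zero.1 <| faithful_left _ fun m => by
    rw [sub_smul, mul_smul, mul_smul, h m, h (c • m), smul_comm, sub_self]

theorem right_comm (faithful_right : ∀ b : B, (∀ m : M, op b • m = 0) → b = 0) {a : A} {b : B}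
    (h : ActsSame M a b) (c : B) : c * b = b * c :=
  sub_eq_zero.1 <| faithful_right _ fun m => by
    rw [op_sub, sub_smul, op_mul, op_mul, mul_smul, mul_smul, ← h m, ← h (op c • m), smul_comm,
      sub_self]

theorem left_unique (faithful_left : ∀ a : A, (∀ m : M, a • m = 0) → a = 0) {a a' : A} {b : B}
    (h : ActsSame M a b) (h' : ActsSame M a' b) : a = a' :=
  sub_eq_zero.1 <| faithful_left _ fun m => by rw [sub_smul, h m, h' m, sub_self]

theorem right_unique (faithful_right : ∀ b : B, (∀ m : M, op b • m = 0) → b = 0) {a : A}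
    {b b' : B} (h : ActsSame M a b) (h' : ActsSame M a b') : b = b' :=
  sub_eq_zero.1 <| faithful_right _ fun m => by rw [op_sub, sub_smul, ← h m, ← h' m, sub_self]

end ActsSame

/-! ### Central elements as pairs acting alike on M. -/

section Center

variable [IsScalarTower R A M] [IsScalarTower R Bᵐᵒᵖ M]

theorem mem_center_of_actsSame (faithful_left : ∀ a : A, (∀ m : M, a • m = 0) → a = 0)
    (faithful_right : ∀ b : B, (∀ m : M, op b • m = 0) → b = 0) {a : A} {b : B}
    (h : ActsSame M a b) :
    (⟨a, 0, b⟩ : TriangularAlgebra A M B) ∈ Subalgebra.center R (TriangularAlgebra A M B) := by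
  refine Subalgebra.mem_center_iff.2 fun y => ?_
  ext
  · exact h.left_comm faithful_left _
  · simpa using (h y.m).symm
  · exact h.right_comm faithful_right _

theorem actsSame_of_mem_center {z : TriangularAlgebra A M B}
    (hz : z ∈ Subalgebra.center R (TriangularAlgebra A M B)) : ActsSame M z.a z.b := fun m => by
  simpa using (congrArg TriangularAlgebra.m (Subalgebra.mem_center_iff.1 hz (ofM A B m))).symm

theorem exists_actsSame_of_center_left
    (hA : ofA M B '' (Subalgebra.center R A : Set A) = centerCorner R (e A M B)) {a : A}
    (ha : ∀ c : A, c * a = a * c) : ∃ b : B, ActsSame M a b := by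
  obtain ⟨z, hz, h⟩ := hA.subset (Set.mem_image_of_mem _ (Subalgebra.mem_center_iff.2 ha))
  have : a = z.a := by simpa using congrArg TriangularAlgebra.a h
  exact ⟨z.b, this ▸ actsSame_of_mem_center hz⟩

theorem exists_actsSame_of_center_right
    (hB : ofB A M '' (Subalgebra.center R B : Set B) = centerCorner R (f A M B)) {b : B}
    (hb : ∀ c : B, c * b = b * c) : ∃ a : A, ActsSame M a b := by
  obtain ⟨z, hz, h⟩ := hB.subset (Set.mem_image_of_mem _ (Subalgebra.mem_center_iff.2 hb))
  have : b = z.b := by simpa using congrArg TriangularAlgebra.b h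
  exact ⟨z.a, this ▸ actsSame_of_mem_center hz⟩

/-- Faithfulness makes partners unique, so pointwise choices are automatically linear. -/
theorem exists_linear_left (faithful_left : ∀ a : A, (∀ m : M, a • m = 0) → a = 0)
    {N : Type*} [AddCommGroup N] [Module R N] (g : N →ₗ[R] B)
    (hg : ∀ x, ∃ a : A, ActsSame M a (g x)) :
    ∃ g' : N →ₗ[R] A, ∀ x, ActsSame M (g' x) (g x) := by
  choose c hc using hg
  refine ⟨{ toFun := c, map_add' := fun x y => ?_, map_smul' := fun r x => ?_ }, hc⟩
  · exact (map_add g x y ▸ hc (x + y)).left_unique faithful_left ((hc x).add (hc y))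
  · exact (map_smul g r x ▸ hc (r • x)).left_unique faithful_left ((hc x).smul r)

theorem exists_linear_right (faithful_right : ∀ b : B, (∀ m : M, op b • m = 0) → b = 0)
    {N : Type*} [AddCommGroup N] [Module R N] (g : N →ₗ[R] A)
    (hg : ∀ x, ∃ b : B, ActsSame M (g x) b) :
    ∃ g' : N →ₗ[R] B, ∀ x, ActsSame M (g x) (g' x) := by
  choose c hc using hg
  refine ⟨{ toFun := c, map_add' := fun x y => ?_, map_smul' := fun r x => ?_ }, hc⟩
  · exact (map_add g x y ▸ hc (x + y)).right_unique faithful_right ((hc x).add (hc y))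
  · exact (map_smul g r x ▸ hc (r • x)).right_unique faithful_right ((hc x).smul r)

end Center

/-! ### Partners for the crossing maps from idempotents and commutators. -/

section Corners

/-- The data left after normalising a Lie `n`-derivation: linear maps between the corners,
subject to the identities that come from the action on `M`. -/
structure CornerIdentities (α : A →ₗ[R] A) (α' : A →ₗ[R] B) (β' : B →ₗ[R] A) (β : B →ₗ[R] B)
    (μ : M →ₗ[R] M) : Prop where
  left (a : A) (m : M) : μ (a • m) = α a • m - op (α' a) • m + a • μ m
  right (b : B) (m : M) : μ (op b • m) = op b • μ m + op (β b) • m - β' b • m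
  mixed (a : A) (b : B) : ActsSame M ⁅a, β' b⁆ ⁅α' a, b⁆

variable {α : A →ₗ[R] A} {α' : A →ₗ[R] B} {β' : B →ₗ[R] A} {β : B →ₗ[R] B} {μ : M →ₗ[R] M}

namespace CornerIdentities

/-- Obtained by expanding μ(acm) once with ac and once with a, then c. The failure of α to be a
derivation is measured by α'. -/
theorem left_defect (H : CornerIdentities α α' β' β μ) (a c : A) (m : M) :
    (α (a * c) - α a * c - a * α c) • m =
      op (α' (a * c)) • m - op (α' a) • c • m - a • op (α' c) • m := by
  have h1 := H.left (a * c) m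
  rw [mul_smul, H.left a, H.left c] at h1
  simp only [sub_smul, mul_smul, smul_add, smul_sub] at h1 ⊢
  grind

theorem right_defect (H : CornerIdentities α α' β' β μ) (b d : B) (m : M) :
    op (β (b * d) - β b * d - b * β d) • m =
      β' (b * d) • m - β' d • op b • m - op d • β' b • m := by
  have h1 := H.right (b * d) m
  rw [op_mul, mul_smul, H.right d, H.right b] at h1
  simp only [op_sub, op_mul, sub_smul, mul_smul, smul_add, smul_sub] at h1 ⊢
  grind

variable [IsScalarTower R A M] [IsScalarTower R Bᵐᵒᵖ M]

theorem exists_left_of_idemComm (H : CornerIdentities α α' β' β μ)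
    (hA : idemCommSubalgebra R A = ⊤) (h1 : ∃ c : A, ActsSame M c (α' 1)) (a : A) :
    ∃ c : A, ActsSame M c (α' a) := by
  have ha : a ∈ idemCommSubalgebra R A := hA ▸ Algebra.mem_top
  induction ha using Algebra.adjoin_induction with
  | mem x hx =>
    rcases hx with hx | ⟨y, z, rfl⟩
    · have hx : x * x = x := hx
      have hd : ∀ m : M, (α x - α x * x - x * α x) • m =
          op (α' x) • m - op (α' x) • x • m - x • op (α' x) • m := fun m => by
        simpa only [hx] using H.left_defect x x m
      set c := α x - α x * x - x * α x
      -- The defect identity reads cm = mα'(x) - 2xmα'(x). Replacing m by xm gives cxm = -xmα'(x),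
      -- hence mα'(x) = cm - 2cxm.
      refine ⟨c - (2 : ℕ) • (c * x), fun m => ?_⟩
      have h2 := hd (x • m)
      rw [smul_smul x x m, hx, sub_self, zero_sub, ← smul_comm x (op (α' x)), smul_smul x x, hx]
        at h2
      have h3 := hd m
      rw [← smul_comm x (op (α' x))] at h3
      rw [sub_smul, smul_assoc, mul_smul, h2, h3]
      rw [two_nsmul]
      abel
    -- The two subtracted terms in `left_defect` are symmetric in y and z, so they cancel in the
    -- difference for (y, z) and (z, y).
    · refine ⟨α ⁅y, z⁆ - ⁅α y, z⁆ - ⁅y, α z⁆, fun m => ?_⟩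
      have h2 := H.left_defect y z m
      have h3 := H.left_defect z y m
      rw [← smul_comm z] at h2
      rw [← smul_comm y] at h3
      simp only [Ring.lie_def, map_sub, op_sub, sub_smul] at h2 h3 ⊢
      grind
  | algebraMap r =>
    obtain ⟨c, hc⟩ := h1
    refine ⟨r • c, ?_⟩
    rw [Algebra.algebraMap_eq_smul_one, map_smul]
    exact hc.smul r
  | add x y _ _ hx hy =>
    obtain ⟨c, hc⟩ := hx
    obtain ⟨d, hd⟩ := hy
    exact ⟨c + d, map_add α' x y ▸ hc.add hd⟩
  | mul x y _ _ hx hy =>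
    obtain ⟨c, hc⟩ := hx
    obtain ⟨d, hd⟩ := hy
    -- Solve `left_defect` for mα'(xy) and substitute the partners c and d of α'(x) and α'(y).
    refine ⟨α (x * y) - α x * y - x * α y + c * y + x * d, fun m => ?_⟩
    rw [add_smul, add_smul, H.left_defect, mul_smul c, mul_smul x d, hc, hd]
    abel

theorem exists_right_of_idemComm (H : CornerIdentities α α' β' β μ)
    (hB : idemCommSubalgebra R B = ⊤) (h1 : ∃ c : B, ActsSame M (β' 1) c) (b : B) :
    ∃ c : B, ActsSame M (β' b) c := by
  have hb : b ∈ idemCommSubalgebra R B := hB ▸ Algebra.mem_top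
  induction hb using Algebra.adjoin_induction with
  | mem x hx =>
    rcases hx with hx | ⟨y, z, rfl⟩
    · have hx : x * x = x := hx
      have hd : ∀ m : M, op (β x - β x * x - x * β x) • m =
          β' x • m - β' x • op x • m - op x • β' x • m := fun m => by
        simpa only [hx] using H.right_defect x x m
      set c := β x - β x * x - x * β x
      refine ⟨c - (2 : ℕ) • (x * c), fun m => ?_⟩
      have hxo : op x * op x = op x := by rw [← op_mul, hx]
      have h2 := hd (op x • m)
      rw [smul_smul (op x) (op x) m, hxo, sub_self, zero_sub, smul_comm (β' x) (op x),
        smul_smul (op x) (op x), hxo] at h2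
      have h3 := hd m
      rw [smul_comm (β' x) (op x)] at h3
      rw [op_sub, op_smul, sub_smul, smul_assoc, op_mul, mul_smul, h2, h3]
      rw [two_nsmul]
      abel
    · refine ⟨β ⁅y, z⁆ - ⁅β y, z⁆ - ⁅y, β z⁆, fun m => ?_⟩
      have h2 := H.right_defect y z m
      have h3 := H.right_defect z y m
      rw [smul_comm (β' z)] at h2
      rw [smul_comm (β' y)] at h3
      simp only [Ring.lie_def, map_sub, op_sub, sub_smul] at h2 h3 ⊢
      grind
  | algebraMap r =>
    obtain ⟨c, hc⟩ := h1
    refine ⟨r • c, ?_⟩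
    rw [Algebra.algebraMap_eq_smul_one, map_smul]
    exact hc.smul r
  | add x y _ _ hx hy =>
    obtain ⟨c, hc⟩ := hx
    obtain ⟨d, hd⟩ := hy
    exact ⟨c + d, map_add β' x y ▸ hc.add hd⟩
  | mul x y _ _ hx hy =>
    obtain ⟨c, hc⟩ := hx
    obtain ⟨d, hd⟩ := hy
    refine ⟨β (x * y) - β x * y - x * β y + c * y + x * d, fun m => ?_⟩
    rw [op_add, op_add, add_smul, add_smul, H.right_defect, op_mul c, op_mul x d, mul_smul,
      mul_smul, ← hc, ← hd]
    abel

end CornerIdentities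

/-- The diagonal projections are algebra homomorphisms and so preserve idempotents and commutators.
This reduces the generation hypothesis on the whole algebra to the one on both corners. -/
theorem map_a_idemCommSubalgebra [IsScalarTower R A M] [IsScalarTower R Bᵐᵒᵖ M]
    {x : TriangularAlgebra A M B} (hx : x ∈ idemCommSubalgebra R (TriangularAlgebra A M B)) :
    x.a ∈ idemCommSubalgebra R A ∧ x.b ∈ idemCommSubalgebra R B := by
  induction hx using Algebra.adjoin_induction with
  | mem x hx =>
    rcases hx with hx | ⟨y, z, rfl⟩
    · exact ⟨Algebra.subset_adjoin (.inl (congrArg TriangularAlgebra.a hx)),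
        Algebra.subset_adjoin (.inl (congrArg TriangularAlgebra.b hx))⟩
    · exact ⟨Algebra.subset_adjoin (.inr ⟨y.a, z.a, rfl⟩),
        Algebra.subset_adjoin (.inr ⟨y.b, z.b, rfl⟩)⟩
  | algebraMap r =>
    rw [Algebra.algebraMap_eq_smul_one]
    exact ⟨Subalgebra.smul_mem _ (one_mem _) r, Subalgebra.smul_mem _ (one_mem _) r⟩
  | add x y _ _ hx hy => exact ⟨add_mem hx.1 hy.1, add_mem hx.2 hy.2⟩
  | mul x y _ _ hx hy => exact ⟨mul_mem hx.1 hy.1, mul_mem hx.2 hy.2⟩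

theorem idemCommSubalgebra_corners [IsScalarTower R A M] [IsScalarTower R Bᵐᵒᵖ M]
    (h : idemCommSubalgebra R (TriangularAlgebra A M B) = ⊤) :
    idemCommSubalgebra R A = ⊤ ∧ idemCommSubalgebra R B = ⊤ :=
  ⟨eq_top_iff.2 fun a _ =>
      (map_a_idemCommSubalgebra (R := R) (x := ofA M B a) (h ▸ Algebra.mem_top)).1,
    eq_top_iff.2 fun b _ =>
      (map_a_idemCommSubalgebra (R := R) (x := ofB A M b) (h ▸ Algebra.mem_top)).2⟩

end Corners

end TriangularAlgebra

/-! ### Evaluating a Lie n-derivation on tuples ending in `f`. -/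

namespace TriangularAlgebra

set_option linter.unusedSectionVars false

open MulOpposite

variable {R A M B : Type*} [CommRing R] [Ring A] [Ring B] [Algebra R A] [Algebra R B]
  [AddCommGroup M] [Module R M] [Module A M] [Module Bᵐᵒᵖ M] [SMulCommClass A Bᵐᵒᵖ M]

theorem rightAd_f_m (k : ℕ) (y : TriangularAlgebra A M B) :
    ((rightAd (f A M B))^[k] y).m = y.m := by
  induction k with
  | zero => rfl
  | succ k ih =>
    rw [Function.iterate_succ_apply']
    simp [rightAd, ih]

theorem lie_f (y : TriangularAlgebra A M B) : ⁅y, f A M B⁆ = ofM A B y.m := by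
  ext <;> simp [Ring.lie_def]

theorem rightAd_f_ofM (k : ℕ) (m : M) :
    (rightAd (f A M B))^[k] (ofM A B m) = ofM A B m :=
  Function.iterate_fixed (lie_f _) k

theorem ofM_lie (m : M) (y : TriangularAlgebra A M B) :
    ⁅ofM A B m, y⁆ = ofM A B (op y.b • m - y.a • m) := by
  ext <;> simp [Ring.lie_def]

/-- An iterated commutator starting in `M` whose further entries are all `f`, with one possible
exception. -/
theorem iterComm_ofM (k : ℕ) (x : Fin (k + 2) → TriangularAlgebra A M B) (m : M)
    (j : Fin (k + 2)) (hj : j ≠ 0) (h0 : x 0 = ofM A B m)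
    (hx : ∀ i, i ≠ 0 → i ≠ j → x i = f A M B) :
    iterComm (k + 2) x = ⁅ofM A B m, x j⁆ := by
  induction k with
  | zero =>
    obtain rfl : j = 1 := by
      fin_cases j
      · exact absurd rfl hj
      · rfl
    rw [← h0]
    rfl
  | succ k ih =>
    rw [iterComm_add_two]
    induction j using Fin.lastCases with
    | last =>
      have h1 : ∀ i : Fin (k + 2), i ≠ 0 → x i.castSucc = f A M B := fun i hi =>
        hx _ (by rwa [Ne, Fin.castSucc_eq_zero_iff]) (Fin.castSucc_lt_last i).ne
      rw [ih _ 1 one_ne_zero h0 fun i hi _ => h1 i hi, h1 1 one_ne_zero, lie_f, ofM_m]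
    | cast j =>
      rw [Ne, Fin.castSucc_eq_zero_iff] at hj
      rw [ih _ j hj h0 fun i hi hij => hx _ (by rwa [Ne, Fin.castSucc_eq_zero_iff])
          (fun h => hij (Fin.castSucc_injective _ h)),
        hx (Fin.last _) (Fin.last_pos).ne' (Fin.castSucc_lt_last j).ne', ofM_lie, lie_f, ofM_m]

section Normalized

variable [IsScalarTower R A M] [IsScalarTower R Bᵐᵒᵖ M]
  {k : ℕ} {φ : TriangularAlgebra A M B →ₗ[R] TriangularAlgebra A M B}

theorem map_one_mem_center (faithful_left : ∀ a : A, (∀ m : M, a • m = 0) → a = 0)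
    (faithful_right : ∀ b : B, (∀ m : M, op b • m = 0) → b = 0)
    (hφ : IsLieNDerivation (k + 2) φ) :
    φ 1 ∈ Subalgebra.center R (TriangularAlgebra A M B) := by
  -- Taking v = `f` removes the M-entry of φ(1); taking v in M makes its two diagonal entries act
  -- alike.
  have key : ∀ v : TriangularAlgebra A M B, (⁅φ 1, v⁆).m = 0 := fun v => by
    have h1 : ∀ y : TriangularAlgebra A M B, ⁅(1 : TriangularAlgebra A M B), y⁆ = 0 := fun y => by simp [Ring.lie_def]
    have h := congrArg TriangularAlgebra.m (hφ.apply_headTwo_of_commute 1 v (f A M B) (h1 v))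
    rwa [rightAd_f_m, h1, add_zero] at h
  have hm : (φ 1).m = 0 := by simpa using key (f A M B)
  have hs : ActsSame M (φ 1).a (φ 1).b := fun m => by
    simpa [sub_eq_zero] using key (ofM A B m)
  have := mem_center_of_actsSame (R := R) faithful_left faithful_right hs
  rwa [← hm] at this

/-- Evaluate at (m, f, …, f), whose commutator is m. Differentiating the first entry gives the
M-part of φ(m); each of the k + 1 entries `f` contributes the same bracket. -/
theorem map_ofM (hφ : IsLieNDerivation (k + 2) φ) (m : M) :
    φ (ofM A B m) = ofM A B (φ (ofM A B m)).m + (k + 1) • ⁅ofM A B m, φ (f A M B)⁆ := by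
  have h := hφ.apply_headTwo (ofM A B m) (f A M B) (f A M B)
  rw [lie_f, ofM_m, rightAd_f_ofM, lie_f, ofM_lie, rightAd_iterate_add, rightAd_f_ofM,
    rightAd_f_ofM, ← ofM_lie, Finset.sum_congr rfl (g := fun _ => ⁅ofM A B m, φ (f A M B)⁆),
    Finset.sum_const, Finset.card_univ, Fintype.card_fin, add_assoc] at h
  · rw [succ_nsmul']
    exact h
  · intro i _
    rw [iterComm_ofM k _ m i.succ.succ (Fin.succ_ne_zero _), Function.update_self]
    · rw [Function.update_of_ne (Fin.succ_ne_zero _).symm]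
      rfl
    · intro j hj hij
      rw [Function.update_of_ne hij]
      induction j using Fin.cases with
      | zero => exact absurd rfl hj
      | succ j =>
        induction j using Fin.cases with
        | zero => rfl
        | succ j => rfl

/-- The bracket lies in M, so comparing M-entries in `map_ofM` leaves k + 1 times it equal to zero.
-/
theorem lie_ofM_map_f (torsion : IsTorsionFreeBy (k + 1) (TriangularAlgebra A M B))
    (hφ : IsLieNDerivation (k + 2) φ) (m : M) : ⁅ofM A B m, φ (f A M B)⁆ = 0 := by
  have h := map_ofM hφ m
  refine torsion _ ?_
  rw [ofM_lie] at h ⊢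
  have hm : ((k + 1) • (ofM A B (op (φ (f A M B)).b • m - (φ (f A M B)).a • m))).m = 0 := by
    simpa using congrArg TriangularAlgebra.m h
  have hs : ∀ (j : ℕ) (y : M), j • ofM A B y = ofM A B (j • y) := fun j y =>
    (map_nsmul (ofMLin ℤ A B) j y).symm
  rw [hs] at hm ⊢
  rw [show (k + 1) • _ = (0 : M) from hm]
  rfl

theorem map_ofM_eq (torsion : IsTorsionFreeBy (k + 1) (TriangularAlgebra A M B))
    (hφ : IsLieNDerivation (k + 2) φ) (m : M) :
    φ (ofM A B m) = ofM A B (φ (ofM A B m)).m := by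
  have h := map_ofM hφ m
  rwa [lie_ofM_map_f torsion hφ, smul_zero, add_zero] at h

theorem map_f_mem_center (faithful_left : ∀ a : A, (∀ m : M, a • m = 0) → a = 0)
    (faithful_right : ∀ b : B, (∀ m : M, op b • m = 0) → b = 0)
    (torsion : IsTorsionFreeBy (k + 1) (TriangularAlgebra A M B))
    (hφ : IsLieNDerivation (k + 2) φ) (he : (φ (e A M B)).m = 0) :
    φ (f A M B) ∈ Subalgebra.center R (TriangularAlgebra A M B) := by
  have hm : (φ (f A M B)).m = 0 := by
    have h1 := Subalgebra.mem_center_iff.1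
      (map_one_mem_center faithful_left faithful_right hφ) (f A M B)
    have h1 : (φ 1).m = 0 := by simpa using (congrArg TriangularAlgebra.m h1).symm
    rw [f, map_sub, sub_m, he, h1, sub_zero]
  have hs : ActsSame M (φ (f A M B)).a (φ (f A M B)).b := fun m => by
    have h := congrArg TriangularAlgebra.m (lie_ofM_map_f torsion hφ m)
    rw [ofM_lie] at h
    exact (sub_eq_zero.1 h).symm
  have := mem_center_of_actsSame (R := R) faithful_left faithful_right hs
  rwa [← hm] at this

theorem map_ofA_m (hφ : IsLieNDerivation (k + 2) φ)
    (hf : φ (f A M B) ∈ Subalgebra.center R (TriangularAlgebra A M B)) (a : A) :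
    (φ (ofA M B a)).m = 0 := by
  have h := hφ.apply_headTwo_of_commute (ofA M B a) (f A M B) (f A M B) (by rw [lie_f]; rfl)
  rw [lie_eq_zero_of_mem_center' hf, add_zero, lie_f, rightAd_f_ofM] at h
  exact congrArg TriangularAlgebra.m h

theorem map_ofB_m (hφ : IsLieNDerivation (k + 2) φ)
    (hf : φ (f A M B) ∈ Subalgebra.center R (TriangularAlgebra A M B)) (b : B) :
    (φ (ofB A M b)).m = 0 := by
  have h := hφ.apply_headTwo_of_commute (ofB A M b) (f A M B) (f A M B) (by rw [lie_f]; rfl)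
  rw [lie_eq_zero_of_mem_center' hf, add_zero, lie_f, rightAd_f_ofM] at h
  exact congrArg TriangularAlgebra.m h

theorem ofA_lie_ofB (a : A) (b : B) : ⁅ofA M B a, ofB A M b⁆ = 0 := by
  ext <;> simp [Ring.lie_def]

theorem lie_corners_of_two (hφ : IsLieNDerivation 2 φ) (a : A) (b : B) :
    ⁅a, (φ (ofB A M b)).a⁆ = 0 ∧ ⁅(φ (ofA M B a)).b, b⁆ = 0 := by
  have h := hφ.apply_headTwo_of_commute (k := 0) (ofA M B a) (ofB A M b) (f A M B)
    (ofA_lie_ofB a b)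
  exact ⟨by simpa [Ring.lie_def] using congrArg TriangularAlgebra.a h,
    by simpa [Ring.lie_def] using congrArg TriangularAlgebra.b h⟩

theorem cornerIdentities (torsion : IsTorsionFreeBy (k + 1) (TriangularAlgebra A M B))
    (hφ : IsLieNDerivation (k + 2) φ)
    (hf : φ (f A M B) ∈ Subalgebra.center R (TriangularAlgebra A M B)) :
    CornerIdentities (M := M) (projA R A M B ∘ₗ φ ∘ₗ ofALin R M B)
      (projB R A M B ∘ₗ φ ∘ₗ ofALin R M B) (projA R A M B ∘ₗ φ ∘ₗ ofBLin R A M)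
      (projB R A M B ∘ₗ φ ∘ₗ ofBLin R A M) (projM R A M B ∘ₗ φ ∘ₗ ofMLin R A B) where
  left a m := by
    change (φ (ofM A B (a • m))).m =
      (φ (ofA M B a)).a • m - op (φ (ofA M B a)).b • m + a • (φ (ofM A B m)).m
    have h := hφ.apply_headTwo_of_central (ofA M B a) (ofM A B m) (f A M B) hf
    have hl : ⁅ofA M B a, ofM A B m⁆ = ofM A B (a • m) := by ext <;> simp [Ring.lie_def]
    rw [hl, rightAd_f_ofM] at h
    have h := congrArg TriangularAlgebra.m h
    rw [rightAd_f_m, map_ofM_eq torsion hφ m] at h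
    simpa using h
  right b m := by
    change (φ (ofM A B (op b • m))).m =
      op b • (φ (ofM A B m)).m + op (φ (ofB A M b)).b • m - (φ (ofB A M b)).a • m
    have h := hφ.apply_headTwo_of_central (ofM A B m) (ofB A M b) (f A M B) hf
    have hl : ⁅ofM A B m, ofB A M b⁆ = ofM A B (op b • m) := by ext <;> simp [Ring.lie_def]
    rw [hl, rightAd_f_ofM] at h
    have h := congrArg TriangularAlgebra.m h
    rw [rightAd_f_m, map_ofM_eq torsion hφ m] at h
    simpa [add_sub_assoc] using h
  mixed a b m := by
    change ⁅a, (φ (ofB A M b)).a⁆ • m = op ⁅(φ (ofA M B a)).b, b⁆ • m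
    -- For n = 2 there is no third entry to hold m, but then both brackets vanish outright.
    -- Otherwise bracket the differentiated relation ⁅a, b⁆ = 0 with m.
    cases k with
    | zero =>
      obtain ⟨h1, h2⟩ := lie_corners_of_two hφ a b
      rw [h1, h2, op_zero, zero_smul, zero_smul]
    | succ k =>
      have h := hφ.apply_headThree_of_commute (ofA M B a) (ofB A M b) (ofM A B m) (f A M B)
        (ofA_lie_ofB a b)
      have h := congrArg TriangularAlgebra.m h
      rw [rightAd_f_m] at h
      have h1 : ∀ c : A, ⁅c, (0 : A)⁆ = 0 := fun c => by simp [Ring.lie_def]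
      have h2 : ∀ c : B, ⁅(0 : B), c⁆ = 0 := fun c => by simp [Ring.lie_def]
      have h3 : (⁅φ (ofA M B a), ofB A M b⁆ + ⁅ofA M B a, φ (ofB A M b)⁆).a =
          ⁅a, (φ (ofB A M b)).a⁆ := by simp [h1]
      have h4 : (⁅φ (ofA M B a), ofB A M b⁆ + ⁅ofA M B a, φ (ofB A M b)⁆).b =
          ⁅(φ (ofA M B a)).b, b⁆ := by simp [h2]
      rw [lie_m, h3, h4] at h
      simpa [sub_eq_zero] using h

end Normalized

/-! ### Assembling the derivation and the central map. -/

section Derivation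

variable [IsScalarTower R A M] [IsScalarTower R Bᵐᵒᵖ M]

/-- A diagonal linear map that is compatible with the action on `M` is a derivation. -/
theorem leibniz_of_corners (faithful_left : ∀ a : A, (∀ m : M, a • m = 0) → a = 0)
    (faithful_right : ∀ b : B, (∀ m : M, op b • m = 0) → b = 0)
    {δ : A → A} {μ : M →+ M} {ε : B → B}
    (hl : ∀ a m, μ (a • m) = δ a • m + a • μ m)
    (hr : ∀ b m, μ (op b • m) = op b • μ m + op (ε b) • m)
    {h : TriangularAlgebra A M B → TriangularAlgebra A M B}
    (hh : ∀ x, h x = ⟨δ x.a, μ x.m, ε x.b⟩) (x y : TriangularAlgebra A M B) :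
    h (x * y) = h x * y + x * h y := by
  have hδ : ∀ a c, δ (a * c) = δ a * c + a * δ c := fun a c =>
    sub_eq_zero.1 <| faithful_left _ fun m => by
      have h1 := hl (a * c) m
      rw [mul_smul, hl a, hl c] at h1
      simp only [sub_smul, add_smul, mul_smul, smul_add] at h1 ⊢
      grind
  have hε : ∀ b d, ε (b * d) = ε b * d + b * ε d := fun b d =>
    sub_eq_zero.1 <| faithful_right _ fun m => by
      have h1 := hr (b * d) m
      rw [op_mul, mul_smul, hr d, hr b] at h1
      simp only [op_sub, op_add, op_mul, sub_smul, add_smul, mul_smul, smul_add] at h1 ⊢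
      grind
  ext
  · simp [hh, hδ]
  · simp only [hh, mul_m, mul_a, mul_b, add_m, map_add, hl, hr]
    abel
  · simp [hh, hε]

theorem isStandard_of_exists (faithful_left : ∀ a : A, (∀ m : M, a • m = 0) → a = 0)
    (faithful_right : ∀ b : B, (∀ m : M, op b • m = 0) → b = 0) {k : ℕ}
    (torsion : IsTorsionFreeBy (k + 1) (TriangularAlgebra A M B))
    {φ : TriangularAlgebra A M B →ₗ[R] TriangularAlgebra A M B}
    (hφ : IsLieNDerivation (k + 2) φ)
    (hf : φ (f A M B) ∈ Subalgebra.center R (TriangularAlgebra A M B))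
    (hA : ∀ a, ∃ c : A, ActsSame M c (φ (ofA M B a)).b)
    (hB : ∀ b, ∃ c : B, ActsSame M (φ (ofB A M b)).a c) : IsStandardLieN (k + 2) φ := by
  have H := cornerIdentities torsion hφ hf
  obtain ⟨σ, hσ⟩ := exists_linear_left faithful_left (projB R A M B ∘ₗ φ ∘ₗ ofALin R M B) hA
  obtain ⟨ρ, hρ⟩ := exists_linear_right faithful_right (projA R A M B ∘ₗ φ ∘ₗ ofBLin R A M) hB
  -- The crossing parts of φ, each completed to a central diagonal matrix by its partner under σ or
  -- ρ.
  let τ : TriangularAlgebra A M B →ₗ[R] TriangularAlgebra A M B :=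
    ofALin R M B ∘ₗ (σ ∘ₗ projA R A M B + projA R A M B ∘ₗ φ ∘ₗ ofBLin R A M ∘ₗ projB R A M B) +
    ofBLin R A M ∘ₗ (projB R A M B ∘ₗ φ ∘ₗ ofALin R M B ∘ₗ projA R A M B + ρ ∘ₗ projB R A M B)
  have hτa (x) : (τ x).a = σ x.a + (φ (ofB A M x.b)).a := add_zero _
  have hτm (x) : (τ x).m = 0 := add_zero _
  have hτb (x) : (τ x).b = (φ (ofA M B x.a)).b + ρ x.b := zero_add _
  have hτ (x) : τ x = ⟨σ x.a + (φ (ofB A M x.b)).a, 0, (φ (ofA M B x.a)).b + ρ x.b⟩ :=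
    TriangularAlgebra.ext (hτa x) (hτm x) (hτb x)
  have hφM (m : M) : φ (ofM A B m) = ofM A B (φ (ofM A B m)).m := map_ofM_eq torsion hφ m
  have hφMa (m : M) : (φ (ofM A B m)).a = 0 := by rw [hφM]; rfl
  have hφMb (m : M) : (φ (ofM A B m)).b = 0 := by rw [hφM]; rfl
  have hsplit (x) : φ x = φ (ofA M B x.a) + φ (ofM A B x.m) + φ (ofB A M x.b) := by
    rw [← map_add, ← map_add, ← eq_sum]
  refine hφ.isStandard (h := φ - τ) (τ := τ) (by omega) ?_ (fun x => ?_) (sub_add_cancel φ τ).symm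
  · refine leibniz_of_corners faithful_left faithful_right
      (δ := fun a => (φ (ofA M B a)).a - σ a)
      (μ := (projM R A M B ∘ₗ φ ∘ₗ ofMLin R A B).toAddMonoidHom)
      (ε := fun b => (φ (ofB A M b)).b - ρ b) (fun a m => ?_) (fun b m => ?_) (fun x => ?_)
    · rw [sub_smul, hσ a m]
      exact H.left a m
    · rw [op_sub, sub_smul, ← hρ b m, ← add_sub_assoc]
      exact H.right b m
    · rw [LinearMap.sub_apply, hsplit, hτ]
      ext
      · simp only [sub_a, add_a, hφMa]
        abel
      · simp only [sub_m, add_m, map_ofA_m hφ hf, map_ofB_m hφ hf, zero_add, add_zero, sub_zero]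
        rfl
      · simp only [sub_b, add_b, hφMb]
        abel
  · rw [hτ]
    exact mem_center_of_actsSame faithful_left faithful_right ((hσ x.a).add (hρ x.b))

end Derivation

end TriangularAlgebra

/-! ### Normalisation and the five cases. -/

open TriangularAlgebra in
theorem mainTheorem7 {R A M B : Type*} [CommRing R] [Ring A] [Ring B] [Algebra R A] [Algebra R B]
    [AddCommGroup M] [Module R M] [Module A M] [Module Bᵐᵒᵖ M] [SMulCommClass A Bᵐᵒᵖ M]
    [IsScalarTower R A M] [IsScalarTower R Bᵐᵒᵖ M]
    (faithful_left : ∀ a : A, (∀ m : M, a • m = 0) → a = 0)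
    (faithful_right : ∀ b : B, (∀ m : M, MulOpposite.op b • m = 0) → b = 0)
    (n : ℕ) (hn : 2 ≤ n)
    (torsion_two : IsTorsionFreeBy 2 (TriangularAlgebra A M B))
    (torsion_pred : IsTorsionFreeBy (n - 1) (TriangularAlgebra A M B))
    (h :
      (idemCommSubalgebra R A = ⊤ ∧ idemCommSubalgebra R B = ⊤) ∨
      (idemCommSubalgebra R (TriangularAlgebra A M B) = ⊤) ∨
      (idemCommSubalgebra R A = ⊤ ∧
        TriangularAlgebra.ofA M B '' (Subalgebra.center R A : Set A) =
          centerCorner R (TriangularAlgebra.e A M B)) ∨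
      (idemCommSubalgebra R B = ⊤ ∧
        TriangularAlgebra.ofB A M '' (Subalgebra.center R B : Set B) =
          centerCorner R (TriangularAlgebra.f A M B)) ∨
      ((3 ≤ n → CentralCommutatorCondition R A ∨ CentralCommutatorCondition R B) ∧
        TriangularAlgebra.ofA M B '' (Subalgebra.center R A : Set A) =
          centerCorner R (TriangularAlgebra.e A M B) ∧
        TriangularAlgebra.ofB A M '' (Subalgebra.center R B : Set B) =
          centerCorner R (TriangularAlgebra.f A M B)))
    (φ : TriangularAlgebra A M B →ₗ[R] TriangularAlgebra A M B)
    (hφ : IsLieNDerivation n φ) :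
    IsStandardLieN n φ := by
  obtain ⟨k, rfl⟩ := Nat.exists_eq_add_of_le' hn
  have torsion : IsTorsionFreeBy (k + 1) (TriangularAlgebra A M B) := torsion_pred
  -- Since ⁅e, m⁆ = m for m in M, this inner derivation has at `e` exactly the M-part of φ(e).
  refine .of_sub_innerDer (ofM A B (φ (e A M B)).m) ?_
  have hψ := hφ.sub (isLieNDerivation_of_leibniz
    (innerDer_leibniz (R := R) (ofM A B (φ (e A M B)).m)) (k + 2))
  have he : ((φ - innerDer R (ofM A B (φ (e A M B)).m)) (e A M B)).m = 0 := by
    simp [innerDer_apply]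
  generalize φ - innerDer R (ofM A B (φ (e A M B)).m) = ψ at hψ he
  have hf := map_f_mem_center faithful_left faithful_right torsion hψ he
  have h1 := map_one_mem_center faithful_left faithful_right hψ
  have H := cornerIdentities torsion hψ hf
  have hA1 : ∃ c : A, ActsSame M c (ψ (ofA M B 1)).b := by
    have : ψ (ofA M B 1) ∈ Subalgebra.center R (TriangularAlgebra A M B) := by
      have h2 := sub_mem h1 hf
      rwa [← map_sub, f, sub_sub_cancel] at h2
    exact ⟨_, actsSame_of_mem_center this⟩
  have hB1 : ∃ c : B, ActsSame M (ψ (ofB A M 1)).a c := by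
    have h2 : ofB A M (1 : B) = f A M B := by ext <;> simp
    exact ⟨_, actsSame_of_mem_center (h2 ▸ hf)⟩
  have hmix : ∀ a b, ActsSame M ⁅a, (ψ (ofB A M b)).a⁆ ⁅(ψ (ofA M B a)).b, b⁆ := H.mixed
  -- A partner makes α'(a) central in B, so the right side of the mixed relation vanishes and β'(b)
  -- is central in A.
  have of_left (hA : ∀ a, ∃ c : A, ActsSame M c (ψ (ofA M B a)).b) (a : A) (b : B) :
      a * (ψ (ofB A M b)).a = (ψ (ofB A M b)).a * a := by
    obtain ⟨c, hc⟩ := hA a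
    refine sub_eq_zero.1 (faithful_left _ fun m => ?_)
    rw [← Ring.lie_def, hmix, Ring.lie_def, hc.right_comm faithful_right b, sub_self,
      MulOpposite.op_zero, zero_smul]
  have of_right (hB : ∀ b, ∃ c : B, ActsSame M (ψ (ofB A M b)).a c) (a : A) (b : B) :
      b * (ψ (ofA M B a)).b = (ψ (ofA M B a)).b * b := by
    obtain ⟨c, hc⟩ := hB b
    refine (sub_eq_zero.1 (faithful_right _ fun m => ?_)).symm
    rw [← Ring.lie_def, ← hmix, Ring.lie_def, hc.left_comm faithful_left a, sub_self, zero_smul]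
  have left_of_top (hA : idemCommSubalgebra R A = ⊤) :
      ∀ a, ∃ c : A, ActsSame M c (ψ (ofA M B a)).b := H.exists_left_of_idemComm hA hA1
  have right_of_top (hB : idemCommSubalgebra R B = ⊤) :
      ∀ b, ∃ c : B, ActsSame M (ψ (ofB A M b)).a c := H.exists_right_of_idemComm hB hB1
  have finish := isStandard_of_exists faithful_left faithful_right torsion hψ hf
  rcases h with ⟨hA, hB⟩ | hT | ⟨hA, hZ⟩ | ⟨hB, hZ⟩ | ⟨hC, hZA, hZB⟩
  · exact finish (left_of_top hA) (right_of_top hB)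
  · obtain ⟨hA, hB⟩ := idemCommSubalgebra_corners hT
    exact finish (left_of_top hA) (right_of_top hB)
  · have hl := left_of_top hA
    exact finish hl fun b => exists_actsSame_of_center_left hZ fun a => of_left hl a b
  · have hr := right_of_top hB
    exact finish (fun a => exists_actsSame_of_center_right hZ fun b => of_right hr a b) hr
  -- Centrality of one crossing map suffices: the centre hypothesis gives it partners, and the mixed
  -- relation then makes the other central too.
  · have both : (∀ a b, a * (ψ (ofB A M b)).a = (ψ (ofB A M b)).a * a) ∨
        (∀ a b, b * (ψ (ofA M B a)).b = (ψ (ofA M B a)).b * b) := by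
      rcases Nat.eq_zero_or_pos k with rfl | hk
      · exact .inl fun a b => sub_eq_zero.1 (lie_corners_of_two hψ a b).1
      · rcases hC (by omega) with hC | hC
        -- By the mixed relation ⁅y, β'(b)⁆ has a partner in B and is therefore central in A, which
        -- is what the commutator condition requires.
        · refine .inl fun a b => Subalgebra.mem_center_iff.1 (hC _ fun y => ?_) a
          rw [← Ring.neg_lie_swap]
          exact neg_mem (Subalgebra.mem_center_iff.2 ((hmix y b).left_comm faithful_left))
        · exact .inr fun a b => Subalgebra.mem_center_iff.1 (hC _ fun y =>
            Subalgebra.mem_center_iff.2 ((hmix a y).right_comm faithful_right)) b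
    rcases both with hl | hr
    · have hB b := exists_actsSame_of_center_left hZA fun a => hl a b
      exact finish (fun a => exists_actsSame_of_center_right hZB fun b => of_right hB a b) hB
    · have hA a := exists_actsSame_of_center_right hZB fun b => hr a b
      exact finish hA fun b => exists_actsSame_of_center_left hZA fun a => of_left hA a b
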